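/- Consider strings over the nine symbols $[,\ ],\ \to,\ \forall,\ \doteq,\ \in,\ w,\ ',\ \bot$. The \emph{variables} are the strings $w, w', w'', \dots$ (that is, $w$ is a variable, and if $\alpha$ is a variable then so is $\alpha'$). The \emph{well-formed formulae of set theory} are defined inductively: $\bot$ is a formula; if $\alpha,\beta$ are variables, then $\alpha\doteq\beta$ and $\alpha\in\beta$ are formulae; and if $\varphi,\psi$ are formulae and $\alpha$ is a variable, then $[\forall\alpha]\varphi$ and $[\varphi\to\psi]$ are formulae. A formula $\varphi$, in which exactly the variables in the set $X$ appear, is \emph{stratified} if there is a function $\sigma\colon X\to\mathbb{Z}$ such that $\sigma(x)=\sigma(y)-1$ whenever $x\in y$ is a subformula of $\varphi$, and $\sigma(x)=\sigma(y)$ whenever $x\doteq y$ is a subformula of $\varphi$. Then the set of well-formed formulae of set theory that are not stratified is not a context-free language. -/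

import Mathlib

/-- The nine symbols `[`, `]`, `→`, `∀`, `≐`, `∈`, `w`, `′`, `⊥` of the language of set theory. -/
inductive SetSymbol where
  | lbrack
  | rbrack
  | arrow
  | all
  | eq
  | mem
  | w
  | prime
  | bot
  deriving DecidableEq

/-- Variables: `w` is a variable, and if `α` is a variable then so is `α′`. -/
inductive SetVar where
  | w : SetVar
  | prime : SetVar → SetVar
  deriving DecidableEq

/-- The string of symbols that a variable is. -/
def SetVar.str : SetVar → List SetSymbol
  | .w => [.w]
  | .prime α => α.str ++ [.prime]

/-- Well-formed formulae of set theory (as parse trees; see `SetFormula.str` for the strings). -/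
inductive SetFormula where
  | bot : SetFormula
  | eq : SetVar → SetVar → SetFormula
  | mem : SetVar → SetVar → SetFormula
  | all : SetVar → SetFormula → SetFormula
  | imp : SetFormula → SetFormula → SetFormula

namespace SetFormula

/-- The string of symbols that a formula is: `⊥`, `α ≐ β`, `α ∈ β`, `[∀α]φ`, `[φ → ψ]`. -/
def str : SetFormula → List SetSymbol
  | bot => [.bot]
  | eq α β => α.str ++ [.eq] ++ β.str
  | mem α β => α.str ++ [.mem] ++ β.str
  | all α φ => [.lbrack, .all] ++ α.str ++ [.rbrack] ++ φ.str
  | imp φ ψ => [.lbrack] ++ φ.str ++ [.arrow] ++ ψ.str ++ [.rbrack]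

/-- The set of variables that appear in a formula (free, bound, or after a quantifier). -/
def vars : SetFormula → Set SetVar
  | bot => ∅
  | eq α β => {α, β}
  | mem α β => {α, β}
  | all α φ => insert α φ.vars
  | imp φ ψ => φ.vars ∪ ψ.vars

/-- The set of subformulae of a formula, itself included. -/
def subformulae : SetFormula → Set SetFormula
  | bot => {bot}
  | eq α β => {eq α β}
  | mem α β => {mem α β}
  | all α φ => insert (all α φ) φ.subformulae
  | imp φ ψ => insert (imp φ ψ) (φ.subformulae ∪ ψ.subformulae)

/-- A stratification of `φ`: an integer-valued function on the variables appearing in `φ` with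
`σ x = σ y - 1` whenever `x ∈ y` is a subformula, and `σ x = σ y` whenever `x ≐ y` is one. -/
def IsStratification (φ : SetFormula) (σ : φ.vars → ℤ) : Prop :=
  (∀ x y : φ.vars, mem x y ∈ φ.subformulae → σ x = σ y - 1) ∧
  (∀ x y : φ.vars, eq x y ∈ φ.subformulae → σ x = σ y)

/-- A formula is stratified if it has a stratification. -/
def IsStratified (φ : SetFormula) : Prop :=
  ∃ σ : φ.vars → ℤ, φ.IsStratification σ

end SetFormula

/-- The formal language, over the nine symbols, of the well-formed formulae of set theory that
are not stratified. Every string is the string of at most one formula, by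
`SetFormula.str_injective` below. -/
def unstratifiedLanguage : Language SetSymbol :=
  {s | ∃ φ : SetFormula, ¬ φ.IsStratified ∧ φ.str = s}

theorem SetVar.str_append_inj {α β : SetVar} {s t : List SetSymbol}
    (hs : s.head? ≠ some .prime) (ht : t.head? ≠ some .prime)
    (h : α.str ++ s = β.str ++ t) : α = β ∧ s = t := by
  have key : ∀ γ : SetVar, ∃ n, γ.str = .w :: List.replicate n .prime ∧
      ∀ δ : SetVar, δ.str = γ.str → δ = γ := by
    have len : ∀ γ : SetVar, 0 < γ.str.length := by
      intro γ; cases γ <;> simp [SetVar.str]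
    intro γ
    induction γ with
    | w =>
      refine ⟨0, by simp [SetVar.str], ?_⟩
      intro δ h
      cases δ with
      | w => rfl
      | prime δ =>
        have h3 := congrArg List.length h
        have h4 := len δ
        simp only [SetVar.str, List.length_append, List.length_cons, List.length_nil] at h3
        omega
    | prime γ ih =>
      obtain ⟨n, h1, h2⟩ := ih
      refine ⟨n + 1, by simp [SetVar.str, h1, List.replicate_succ'], ?_⟩
      intro δ h
      cases δ with
      | w =>
        have h3 := congrArg List.length h
        have h4 := len γ
        simp only [SetVar.str, List.length_append, List.length_cons, List.length_nil] at h3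
        omega
      | prime δ =>
        simp only [SetVar.str, List.append_left_inj] at h
        rw [h2 δ h]
  have rep : ∀ m n : ℕ, List.replicate m SetSymbol.prime ++ s =
      List.replicate n SetSymbol.prime ++ t → m = n ∧ s = t := by
    intro m
    induction m with
    | zero =>
      intro n h
      cases n with
      | zero => simpa using h
      | succ n => simp [List.replicate_succ] at h; simp [h] at hs
    | succ m ih =>
      intro n h
      cases n with
      | zero => simp [List.replicate_succ] at h; simp [← h] at ht
      | succ n =>
        simp only [List.replicate_succ, List.cons_append, List.cons.injEq, true_and] at h
        exact ⟨congrArg (· + 1) (ih n h).1, (ih n h).2⟩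
  obtain ⟨m, hm, -⟩ := key α
  obtain ⟨n, hn, hβ⟩ := key β
  rw [hm, hn] at h
  simp only [List.cons_append, List.cons.injEq, true_and] at h
  obtain ⟨rfl, h'⟩ := rep m n h
  exact ⟨hβ α (by rw [hm, hn]), h'⟩

theorem SetVar.str_eq_cons (α : SetVar) : ∃ l, α.str = .w :: l := by
  induction α with
  | w => exact ⟨[], rfl⟩
  | prime α ih => obtain ⟨l, h⟩ := ih; exact ⟨l ++ [.prime], by simp [SetVar.str, h]⟩

theorem SetFormula.str_append_inj (φ ψ : SetFormula) (s t : List SetSymbol)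
    (hs : s.head? ≠ some .prime) (ht : t.head? ≠ some .prime)
    (h : φ.str ++ s = ψ.str ++ t) : φ = ψ ∧ s = t := by
  have first : ∀ χ : SetFormula, ∃ a l, χ.str = a :: l ∧ a ≠ .all ∧ a ≠ .prime := by
    intro χ
    cases χ with
    | bot => exact ⟨_, _, rfl, by simp⟩
    | eq α β => obtain ⟨l, h⟩ := α.str_eq_cons; simp [str, h]
    | mem α β => obtain ⟨l, h⟩ := α.str_eq_cons; simp [str, h]
    | all α φ => simp [str]
    | imp φ ψ => simp [str]
  induction φ generalizing ψ s t with
  | bot =>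
    cases ψ with
    | bot => simpa [str] using h
    | eq α β => obtain ⟨l, hl⟩ := α.str_eq_cons; simp [str, hl] at h
    | mem α β => obtain ⟨l, hl⟩ := α.str_eq_cons; simp [str, hl] at h
    | all α φ => simp [str] at h
    | imp φ ψ => simp [str] at h
  | eq α β =>
    obtain ⟨k, hk⟩ := α.str_eq_cons
    cases ψ with
    | bot => simp [str, hk] at h
    | eq γ δ =>
      simp only [str, List.append_assoc] at h
      obtain ⟨rfl, h⟩ := SetVar.str_append_inj (by simp) (by simp) h
      obtain ⟨rfl, hst⟩ := SetVar.str_append_inj hs ht (by simpa using h)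
      exact ⟨rfl, hst⟩
    | mem γ δ =>
      simp only [str, List.append_assoc] at h
      obtain ⟨rfl, h⟩ := SetVar.str_append_inj (by simp) (by simp) h
      simp at h
    | all γ φ => simp [str, hk] at h
    | imp φ ψ => simp [str, hk] at h
  | mem α β =>
    obtain ⟨k, hk⟩ := α.str_eq_cons
    cases ψ with
    | bot => simp [str, hk] at h
    | mem γ δ =>
      simp only [str, List.append_assoc] at h
      obtain ⟨rfl, h⟩ := SetVar.str_append_inj (by simp) (by simp) h
      obtain ⟨rfl, hst⟩ := SetVar.str_append_inj hs ht (by simpa using h)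
      exact ⟨rfl, hst⟩
    | eq γ δ =>
      simp only [str, List.append_assoc] at h
      obtain ⟨rfl, h⟩ := SetVar.str_append_inj (by simp) (by simp) h
      simp at h
    | all γ φ => simp [str, hk] at h
    | imp φ ψ => simp [str, hk] at h
  | all α φ ih =>
    cases ψ with
    | bot => simp [str] at h
    | eq γ δ => obtain ⟨l, hl⟩ := γ.str_eq_cons; simp [str, hl] at h
    | mem γ δ => obtain ⟨l, hl⟩ := γ.str_eq_cons; simp [str, hl] at h
    | all γ ψ =>
      simp only [str, List.append_assoc, List.append_cancel_left_eq] at h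
      obtain ⟨rfl, h⟩ := SetVar.str_append_inj (by simp) (by simp) h
      obtain ⟨rfl, hst⟩ := ih ψ s t hs ht (by simpa using h)
      exact ⟨rfl, hst⟩
    | imp ψ χ =>
      obtain ⟨a, l, hl, ha, -⟩ := first ψ
      simp [str, hl] at h
      exact absurd h.1.symm ha
  | imp φ₁ φ₂ ih₁ ih₂ =>
    cases ψ with
    | bot => simp [str] at h
    | eq γ δ => obtain ⟨l, hl⟩ := γ.str_eq_cons; simp [str, hl] at h
    | mem γ δ => obtain ⟨l, hl⟩ := γ.str_eq_cons; simp [str, hl] at h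
    | all γ ψ =>
      obtain ⟨a, l, hl, ha, -⟩ := first φ₁
      simp [str, hl] at h
      exact absurd h.1 ha
    | imp ψ₁ ψ₂ =>
      simp only [str, List.append_assoc, List.append_cancel_left_eq] at h
      obtain ⟨rfl, h⟩ := ih₁ ψ₁ _ _ (by simp) (by simp) h
      simp only [List.append_cancel_left_eq] at h
      obtain ⟨rfl, h⟩ := ih₂ ψ₂ _ _ (by simp) (by simp) h
      exact ⟨rfl, by simpa using h⟩

/-- Unique readability: a string is the string of at most one formula. -/
theorem SetFormula.str_injective : Function.Injective SetFormula.str := by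
  intro φ ψ h
  exact (SetFormula.str_append_inj φ ψ [] [] (by simp) (by simp) (by simpa using h)).1

/-!
The proof applies the pumping lemma for context-free languages, in the direction that deletes, to
the unstratified formulae `[α ∈ β → α ≐ β]`.

For the pumping lemma, derivations are recorded as forests of parse trees with their numbers of
inner nodes (`DerivesForest`). A forest in which no nonterminal repeats along a path has a yield of
bounded length (`RepetitionFree.length_le`). In any other forest, take a node whose nonterminal
recurs below it while nothing repeats inside the trees under it: its yield is short, and replacing
it by its recurrence deletes two nearby factors of the word and makes the forest smaller
(`DerivesForest.repetitionFree_or_pump`). Starting from a smallest forest, the deleted part is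
nonempty (`Language.IsContextFree.exists_pump_down`).

Now let `α` and `β` be variables with `p + 1` and `2 * p + 2` primes, where `p` is the pumping
constant. If deleting leaves a formula, comparing symbol counts shows that only primes were deleted
(`primes_of_delete`), so the result is `[α' ∈ β' → γ' ≐ δ']`. By locality, the deleted primes lie in
a single variable or in two neighbouring ones, so at least one of the two variables of each of the
pairs of occurrences (first, third) and (second, fourth) is still intact, and at least one pair has
become unequal. The lengths chosen then also exclude `α' = β'` and `{α', β'} = {γ', δ'}`, and
without those coincidences the formula is stratified (`exists_stratification`), so it lies outside
the language.
-/

/-! ### Forests of parse trees -/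

namespace ContextFreeGrammar

variable {T : Type*}

/-- `g.DerivesForest n a v`: there is a sequence of parse trees of `g` whose roots spell `a`, whose
leaves spell `v`, and which have `n` inner nodes altogether. -/
inductive DerivesForest (g : ContextFreeGrammar T) :
    ℕ → List (Symbol T g.NT) → List T → Prop
  | nil : DerivesForest g 0 [] []
  | terminal {n a v} (t : T) (h : DerivesForest g n a v) :
      DerivesForest g n (.terminal t :: a) (t :: v)
  | node {n m a u v} (r : ContextFreeRule T g.NT) (hr : r ∈ g.rules)
      (h : DerivesForest g n r.output u) (h' : DerivesForest g m a v) :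
      DerivesForest g (n + m + 1) (.nonterminal r.input :: a) (u ++ v)

/-- As `DerivesForest`, with the further condition that no nonterminal occurs twice on a path down
from a root and that no nonterminal of `F` occurs at all. -/
inductive RepetitionFree (g : ContextFreeGrammar T) :
    ℕ → Set g.NT → List (Symbol T g.NT) → List T → Prop
  | nil (F) : RepetitionFree g 0 F [] []
  | terminal {n F a v} (t : T) (h : RepetitionFree g n F a v) :
      RepetitionFree g n F (.terminal t :: a) (t :: v)
  | node {n m F a u v} (r : ContextFreeRule T g.NT) (hr : r ∈ g.rules) (hF : r.input ∉ F)
      (h : RepetitionFree g n (insert r.input F) r.output u) (h' : RepetitionFree g m F a v) :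
      RepetitionFree g (n + m + 1) F (.nonterminal r.input :: a) (u ++ v)

variable {g : ContextFreeGrammar T}

lemma DerivesForest.append {n m : ℕ} {a b : List (Symbol T g.NT)} {u v : List T}
    (ha : g.DerivesForest n a u) (hb : g.DerivesForest m b v) :
    g.DerivesForest (n + m) (a ++ b) (u ++ v) := by
  induction ha with
  | nil => simpa using hb
  | terminal t _ ih => exact ih.terminal t
  | node r hr h _ _ ih =>
    have := DerivesForest.node r hr h ih
    simpa [add_assoc, add_comm, add_left_comm] using this

lemma DerivesForest.exists_of_append {n : ℕ} {a b : List (Symbol T g.NT)} {w : List T}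
    (h : g.DerivesForest n (a ++ b) w) :
    ∃ m k u v, w = u ++ v ∧ g.DerivesForest m a u ∧ g.DerivesForest k b v := by
  induction a generalizing n w with
  | nil => exact ⟨0, n, [], w, rfl, .nil, h⟩
  | cons x a ih =>
    cases h with
    | terminal t h =>
      obtain ⟨m, k, u, v, rfl, h₁, h₂⟩ := ih h
      exact ⟨m, k, t :: u, v, rfl, h₁.terminal t, h₂⟩
    | node r hr h h' =>
      obtain ⟨m, k, u, v, rfl, h₁, h₂⟩ := ih h'
      exact ⟨_, k, _ ++ u, v, by simp, .node r hr h h₁, h₂⟩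

lemma DerivesForest.derives {n : ℕ} {a : List (Symbol T g.NT)} {w : List T}
    (h : g.DerivesForest n a w) : g.Derives a (w.map .terminal) := by
  induction h with
  | nil => exact Derives.refl _
  | terminal t _ ih => exact ih.append_left [.terminal t]
  | @node _ _ a u v r hr _ _ ih ih' =>
    rw [List.map_append]
    have h₀ : g.Produces [.nonterminal r.input] r.output :=
      ⟨r, hr, ContextFreeRule.Rewrites.input_output⟩
    exact ((h₀.single.trans ih).append_right a).trans (ih'.append_left _)

lemma derivesForest_terminals (w : List T) :
    g.DerivesForest 0 (w.map Symbol.terminal) w := by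
  induction w with
  | nil => exact .nil
  | cons t w ih => exact ih.terminal t

lemma Derives.exists_derivesForest {a : List (Symbol T g.NT)} {w : List T}
    (h : g.Derives a (w.map .terminal)) : ∃ n, g.DerivesForest n a w := by
  induction h using Relation.ReflTransGen.head_induction_on with
  | refl => exact ⟨0, derivesForest_terminals w⟩
  | head hab _ ih =>
    obtain ⟨n, hn⟩ := ih
    obtain ⟨r, hr, hrw⟩ := hab
    obtain ⟨p, q, rfl, rfl⟩ := hrw.exists_parts
    obtain ⟨_, _, u, v, rfl, h₁, h₂⟩ := hn.exists_of_append
    obtain ⟨_, _, u₁, u₂, rfl, h₃, h₄⟩ := h₁.exists_of_append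
    have := h₃.append (DerivesForest.node r hr h₄ h₂)
    exact ⟨_, by simpa using this⟩

lemma RepetitionFree.derivesForest {n : ℕ} {F : Set g.NT} {a : List (Symbol T g.NT)} {w : List T}
    (h : g.RepetitionFree n F a w) : g.DerivesForest n a w := by
  induction h with
  | nil => exact .nil
  | terminal t _ ih => exact ih.terminal t
  | node r hr _ _ _ ih ih' => exact .node r hr ih ih'

/-! ### The pumping lemma -/

/-- The nonterminals that some rule of the grammar rewrites. -/
def inputs (g : ContextFreeGrammar T) : Set g.NT :=
  ContextFreeRule.input '' (g.rules : Set (ContextFreeRule T g.NT))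

/-- A positive bound for the lengths of the right-hand sides of the rules. -/
def width (g : ContextFreeGrammar T) : ℕ := g.rules.sup (fun r ↦ r.output.length) + 1

lemma finite_inputs (g : ContextFreeGrammar T) : g.inputs.Finite :=
  g.rules.finite_toSet.image ContextFreeRule.input

lemma length_output_le_width {r : ContextFreeRule T g.NT} (hr : r ∈ g.rules) :
    r.output.length ≤ g.width :=
  (Finset.le_sup (f := fun r : ContextFreeRule T g.NT ↦ r.output.length) hr).trans
    (Nat.le_succ _)

/-- Each step down a path uses up a nonterminal outside `F`, so the trees have height at most the
number of those, and each step multiplies the yield by at most the width. -/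
lemma RepetitionFree.length_le {n : ℕ} {F : Set g.NT} {a : List (Symbol T g.NT)} {w : List T}
    (h : g.RepetitionFree n F a w) :
    w.length ≤ a.length * g.width ^ (g.inputs \ F).ncard := by
  have hpos : 0 < g.width := Nat.succ_pos _
  induction h with
  | nil => simp
  | @terminal _ F _ _ t _ ih =>
    have := Nat.pow_pos (n := (g.inputs \ F).ncard) hpos
    simp only [List.length_cons, add_mul]
    omega
  | @node n m F a u v r hr hF _ _ ih ih' =>
    have hlt : (g.inputs \ insert r.input F).ncard < (g.inputs \ F).ncard := by
      apply Set.ncard_lt_ncard _ (g.finite_inputs.subset Set.sdiff_subset)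
      refine ⟨Set.sdiff_subset_sdiff_right (Set.subset_insert _ _), fun hsub ↦ ?_⟩
      exact (hsub ⟨⟨r, hr, rfl⟩, hF⟩).2 (Set.mem_insert _ _)
    have hu : u.length ≤ g.width ^ (g.inputs \ F).ncard :=
      calc u.length ≤ r.output.length * g.width ^ (g.inputs \ insert r.input F).ncard := ih
        _ ≤ g.width * g.width ^ (g.inputs \ insert r.input F).ncard :=
          Nat.mul_le_mul_right _ (length_output_le_width hr)
        _ = g.width ^ ((g.inputs \ insert r.input F).ncard + 1) := by rw [pow_succ, mul_comm]
        _ ≤ _ := Nat.pow_le_pow_right hpos hlt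
    simp only [List.length_cons, List.length_append, add_mul, one_mul]
    omega

/-- Either the nonterminal `A` does not occur in the forest, or some occurrence of it cuts out a
tree whose yield is a factor of the whole yield. -/
lemma RepetitionFree.insert_or_exists_subtree {n : ℕ} {F : Set g.NT}
    {a : List (Symbol T g.NT)} {w : List T} (h : g.RepetitionFree n F a w) (A : g.NT) :
    g.RepetitionFree n (insert A F) a w ∨
      ∃ u x z m, w = u ++ x ++ z ∧ m ≤ n ∧ g.DerivesForest m [.nonterminal A] x := by
  induction h with
  | nil => exact .inl (.nil _)
  | terminal t _ ih =>
    rcases ih with ih | ⟨u, x, z, m, rfl, hm, hx⟩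
    · exact .inl (ih.terminal t)
    · exact .inr ⟨t :: u, x, z, m, rfl, hm, hx⟩
  | @node n k F a v w r hr hF h h' ih ih' =>
    by_cases hA : r.input = A
    · refine .inr ⟨[], v, w, n + 1, by simp, by omega, ?_⟩
      simpa [hA] using DerivesForest.node r hr h.derivesForest .nil
    · rcases ih with ih | ⟨u, x, z, m, rfl, hm, hx⟩
      · rcases ih' with ih' | ⟨u, x, z, m, rfl, hm, hx⟩
        · exact .inl (.node r hr (by simp [hA, hF]) (Set.insert_comm _ _ _ ▸ ih) ih')
        · exact .inr ⟨v ++ u, x, z, m, by simp, by omega, hx⟩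
      · exact .inr ⟨u, x, z ++ w, m, by simp, by omega, hx⟩

/-- The bound on the length of the factor around the deleted parts in the pumping lemma. -/
noncomputable def pumpingConstant (g : ContextFreeGrammar T) : ℕ :=
  g.width * g.width ^ g.inputs.ncard

lemma DerivesForest.repetitionFree_or_pump {n : ℕ} {a : List (Symbol T g.NT)} {w : List T}
    (h : g.DerivesForest n a w) :
    g.RepetitionFree n ∅ a w ∨
      ∃ u v x y z m, w = u ++ v ++ x ++ y ++ z ∧ (v ++ x ++ y).length ≤ g.pumpingConstant ∧
        m < n ∧ g.DerivesForest m a (u ++ x ++ z) := by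
  induction h with
  | nil => exact .inl (.nil _)
  | terminal t _ ih =>
    rcases ih with ih | ⟨u, v, x, y, z, m, rfl, hl, hm, hx⟩
    · exact .inl (ih.terminal t)
    · exact .inr ⟨t :: u, v, x, y, z, m, rfl, hl, hm, hx.terminal t⟩
  | @node n k a w w' r hr h h' ih ih' =>
    rcases ih with ih | ⟨u, v, x, y, z, m, rfl, hl, hm, hx⟩
    · rcases ih' with ih' | ⟨u, v, x, y, z, m, rfl, hl, hm, hx⟩
      · rcases ih.insert_or_exists_subtree r.input with hF | ⟨v, x, y, m, rfl, hm, hx⟩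
        · exact .inl (.node r hr (by simp) hF ih')
        · refine .inr ⟨[], v, x, y, w', m + k, by simp, ?_, by omega, ?_⟩
          · refine ih.length_le.trans ?_
            rw [Set.sdiff_empty]
            exact Nat.mul_le_mul_right _ (length_output_le_width hr)
          · simpa using hx.append h'
      · refine .inr ⟨w ++ u, v, x, y, z, n + m + 1, by simp, hl, by omega, ?_⟩
        simpa using DerivesForest.node r hr h hx
    · refine .inr ⟨u, v, x, y, z ++ w', m + k + 1, by simp, hl, by omega, ?_⟩
      simpa using DerivesForest.node r hr hx h'

end ContextFreeGrammar

/-- The pumping lemma for context-free languages, restricted to the case where the two pumped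
factors are deleted. -/
theorem Language.IsContextFree.exists_pump_down {T : Type*} {L : Language T}
    (hL : L.IsContextFree) :
    ∃ p : ℕ, ∀ w ∈ L, p < w.length → ∃ u v x y z : List T,
      w = u ++ v ++ x ++ y ++ z ∧ (v ++ x ++ y).length ≤ p ∧ 0 < (v ++ y).length ∧
        u ++ x ++ z ∈ L := by
  classical
  obtain ⟨g, rfl⟩ := hL
  refine ⟨g.pumpingConstant, fun w hw hlen ↦ ?_⟩
  have hex : ∃ n, g.DerivesForest n [.nonterminal g.initial] w :=
    ContextFreeGrammar.Derives.exists_derivesForest hw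
  rcases (Nat.find_spec hex).repetitionFree_or_pump with h | ⟨u, v, x, y, z, m, hw', hl, hm, hx⟩
  · have h₁ := h.length_le
    rw [Set.sdiff_empty, List.length_singleton, one_mul] at h₁
    have h₂ : g.width ^ g.inputs.ncard ≤ g.pumpingConstant :=
      Nat.le_mul_of_pos_left _ (Nat.succ_pos _)
    omega
  · refine ⟨u, v, x, y, z, hw', hl, ?_, hx.derives⟩
    by_contra h0
    obtain ⟨rfl, rfl⟩ : v = [] ∧ y = [] := by simpa using h0
    exact Nat.find_min hex hm (by simpa [hw'] using hx)

/-! ### Symbol counts of formulae -/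

/-- The number of primes of a variable. -/
def SetVar.primes : SetVar → ℕ
  | .w => 0
  | .prime α => α.primes + 1

lemma SetVar.str_eq_replicate (α : SetVar) :
    α.str = .w :: List.replicate α.primes .prime := by
  induction α with
  | w => rfl
  | prime α ih => simp [SetVar.str, SetVar.primes, ih, List.replicate_succ']

lemma SetVar.primes_injective : Function.Injective SetVar.primes := by
  intro α β h
  refine (SetVar.str_append_inj (s := []) (t := []) (by simp) (by simp) ?_).1
  simp [SetVar.str_eq_replicate, h]

lemma SetVar.exists_primes_eq (n : ℕ) : ∃ α : SetVar, α.primes = n := by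
  induction n with
  | zero => exact ⟨.w, rfl⟩
  | succ n ih => obtain ⟨α, rfl⟩ := ih; exact ⟨.prime α, rfl⟩

lemma SetVar.count_str {c : SetSymbol} (α : SetVar) :
    α.str.count c = (if c = .w then 1 else 0) + (if c = .prime then α.primes else 0) := by
  cases c <;> simp [SetVar.str_eq_replicate, List.count_replicate]

lemma SetVar.filter_str (α : SetVar) : α.str.filter (· ≠ .prime) = [.w] := by
  simp [SetVar.str_eq_replicate]

/-- Linear relations between the numbers of occurrences of the symbols in a formula. -/
lemma SetFormula.count_str (φ : SetFormula) :
    φ.str.count .lbrack = φ.str.count .rbrack ∧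
    φ.str.count .lbrack = φ.str.count .arrow + φ.str.count .all ∧
    φ.str.count .bot + φ.str.count .eq + φ.str.count .mem = φ.str.count .arrow + 1 ∧
    φ.str.count .w = 2 * (φ.str.count .eq + φ.str.count .mem) + φ.str.count .all := by
  induction φ with
  | bot => decide
  | eq α β => simp [str, SetVar.count_str]
  | mem α β => simp [str, SetVar.count_str]
  | all α φ ih => simp [str, SetVar.count_str]; omega
  | imp φ ψ ih₁ ih₂ => simp [str]; omega

/-- Deleting two factors of a formula `[α ∈ β → γ ≐ δ]` that leave a formula, and that do not
reach from the first symbol to the last, deletes only primes: the first and the last symbol are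
its only brackets, so a bracket and hence all symbols but primes are kept. -/
lemma primes_of_delete {α β γ δ : SetVar} {φ : SetFormula} {u v x y z : List SetSymbol}
    (hs : (SetFormula.imp (.mem α β) (.eq γ δ)).str = u ++ v ++ x ++ y ++ z)
    (hφ : φ.str = u ++ x ++ z)
    (hlen : (v ++ x ++ y).length < (SetFormula.imp (.mem α β) (.eq γ δ)).str.length) :
    ∀ c ≠ SetSymbol.prime, c ∉ v ∧ c ∉ y := by
  have h₁ : (SetFormula.imp (.mem α β) (.eq γ δ)).str.count .lbrack = 1 := by
    simp [SetFormula.str, SetVar.count_str]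
  have h₂ : (SetFormula.imp (.mem α β) (.eq γ δ)).str.count .arrow = 1 := by
    simp [SetFormula.str, SetVar.count_str]
  have h₃ : (SetFormula.imp (.mem α β) (.eq γ δ)).str.count .bot = 0 := by
    simp [SetFormula.str, SetVar.count_str]
  have hcount := (SetFormula.imp (.mem α β) (.eq γ δ)).count_str
  have hφcount := φ.count_str
  have hhead : (SetFormula.imp (.mem α β) (.eq γ δ)).str.head? = some .lbrack := rfl
  have hlast : (SetFormula.imp (.mem α β) (.eq γ δ)).str.getLast? = some .rbrack :=
    List.getLast?_concat
  generalize (SetFormula.imp (.mem α β) (.eq γ δ)).str = s at *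
  generalize φ.str = t at *
  have hc : ∀ c, s.count c = t.count c + v.count c + y.count c := by
    intro c
    rw [hs, hφ]
    simp only [List.count_append]
    omega
  -- If the deleted factors miss the first or the last symbol, a bracket survives.
  have hb : t.count .lbrack ≠ 0 := by
    cases u with
    | cons c u =>
      obtain rfl : c = .lbrack := by simpa [hs] using hhead
      simp [hφ]
    | nil =>
      rw [hφcount.1]
      rcases List.eq_nil_or_concat z with rfl | ⟨z, c, rfl⟩
      · simp [hs] at hlen
      · obtain rfl : c = .rbrack := by simpa [hs] using hlast
        simp [hφ]
  obtain ⟨a₁, a₂, a₃, a₄⟩ := hcount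
  obtain ⟨b₁, b₂, b₃, b₄⟩ := hφcount
  have e₁ := hc .lbrack
  have e₂ := hc .rbrack
  have e₃ := hc .arrow
  have e₄ := hc .all
  have e₅ := hc .eq
  have e₆ := hc .mem
  have e₇ := hc .w
  have e₈ := hc .bot
  -- No bracket is deleted; the linear relations carry this over to the other symbols.
  have f₁ : t.count .lbrack = s.count .lbrack := by clear * - e₁ h₁ hb; omega
  have f₂ : t.count .rbrack = s.count .rbrack := by rw [← a₁, ← b₁, f₁]
  have f₄ : s.count .all = 0 := by clear * - a₂ h₁ h₂; omega
  have f₄' : t.count .all = 0 := by clear * - e₄ f₄; omega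
  have f₃ : t.count .arrow = s.count .arrow := by clear * - a₂ b₂ f₁ f₄ f₄'; omega
  have f₈ : t.count .bot = 0 := by clear * - e₈ h₃; omega
  have f₅ : t.count .eq + t.count .mem = s.count .eq + s.count .mem := by
    clear * - a₃ b₃ f₃ f₈ h₃; omega
  have f₇ : t.count .w = s.count .w := by rw [a₄, b₄, f₅, f₄, f₄']
  intro c hcp
  simp only [← List.count_eq_zero]
  cases c with
  | prime => exact absurd rfl hcp
  | lbrack => clear * - e₁ f₁; omega
  | rbrack => clear * - e₂ f₂; omega
  | arrow => clear * - e₃ f₃; omega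
  | all => clear * - e₄ f₄ f₄'; omega
  | eq => clear * - e₅ e₆ f₅; omega
  | mem => clear * - e₅ e₆ f₅; omega
  | w => clear * - e₇ f₇; omega
  | bot => clear * - e₈ f₈ h₃; omega

/-- Apart from the numbers of primes, the symbols determine the shape of the formula. -/
lemma SetFormula.exists_of_filter_eq {φ : SetFormula}
    (h : φ.str.filter (· ≠ .prime) = [.lbrack, .w, .mem, .w, .arrow, .w, .eq, .w, .rbrack]) :
    ∃ α β γ δ, φ = imp (mem α β) (eq γ δ) := by
  have hv := SetVar.filter_str
  simp only [ne_eq, decide_not] at h hv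
  cases φ with
  | bot => simp [str] at h
  | eq α β => simp [str, hv] at h
  | mem α β => simp [str, hv] at h
  | all α φ => simp [str] at h
  | imp φ ψ =>
    cases φ with
    | bot => simp [str] at h
    | eq α β => simp [str, hv] at h
    | all α φ => simp [str] at h
    | imp φ ψ => simp [str] at h
    | mem α β =>
      cases ψ with
      | bot => simp [str, hv] at h
      | mem γ δ => simp [str, hv] at h
      | all γ φ => simp [str, hv] at h
      | imp φ ψ => simp [str, hv] at h
      | eq γ δ => exact ⟨α, β, γ, δ, rfl⟩

/-! ### Positions of the deleted primes -/

/-- The number of primes before the first occurrence of the symbol `c`. -/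
def primesBefore (c : SetSymbol) (l : List SetSymbol) : ℕ :=
  (l.takeWhile (· ≠ c)).count .prime

lemma primesBefore_le_count (c : SetSymbol) (l : List SetSymbol) :
    primesBefore c l ≤ l.count .prime :=
  (List.takeWhile_sublist _).count_le _

lemma primesBefore_append_of_mem {c : SetSymbol} {l : List SetSymbol} (h : c ∈ l)
    (t : List SetSymbol) : primesBefore c (l ++ t) = primesBefore c l := by
  unfold primesBefore
  rw [List.takeWhile_append, if_neg]
  intro hl
  have h' := (List.takeWhile_sublist _).eq_of_length hl
  rw [List.takeWhile_eq_self_iff] at h'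
  simpa using h' c h

lemma primesBefore_append_of_notMem {c : SetSymbol} {l : List SetSymbol} (h : c ∉ l)
    (t : List SetSymbol) : primesBefore c (l ++ t) = l.count .prime + primesBefore c t := by
  unfold primesBefore
  rw [List.takeWhile_append_of_pos, List.count_append]
  intro a ha
  simp only [ne_eq, decide_eq_true_eq]
  rintro rfl
  exact h ha

/-- A symbol that is not deleted lies in one of the three remaining factors, which tells how many
primes are lost before it. -/
lemma primesBefore_delete {c : SetSymbol} {u v x y : List SetSymbol} (hv : c ∉ v) (hy : c ∉ y)
    (z : List SetSymbol) :
    (∃ k ≤ u.count .prime, primesBefore c (u ++ v ++ x ++ y ++ z) = k ∧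
      primesBefore c (u ++ x ++ z) = k) ∨
    (∃ k ≤ x.count .prime,
      primesBefore c (u ++ v ++ x ++ y ++ z) = u.count .prime + v.count .prime + k ∧
      primesBefore c (u ++ x ++ z) = u.count .prime + k) ∨
    (∃ k, primesBefore c (u ++ v ++ x ++ y ++ z) =
        u.count .prime + v.count .prime + x.count .prime + y.count .prime + k ∧
      primesBefore c (u ++ x ++ z) = u.count .prime + x.count .prime + k) := by
  simp only [List.append_assoc]
  by_cases hu : c ∈ u
  · exact .inl ⟨_, primesBefore_le_count c u, primesBefore_append_of_mem hu _,
      primesBefore_append_of_mem hu _⟩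
  right
  by_cases hx : c ∈ x
  · refine .inl ⟨_, primesBefore_le_count c x, ?_, ?_⟩
    · rw [primesBefore_append_of_notMem hu, primesBefore_append_of_notMem hv,
        primesBefore_append_of_mem hx, add_assoc]
    · rw [primesBefore_append_of_notMem hu, primesBefore_append_of_mem hx]
  · refine .inr ⟨primesBefore c z, ?_, ?_⟩
    · rw [primesBefore_append_of_notMem hu, primesBefore_append_of_notMem hv,
        primesBefore_append_of_notMem hx, primesBefore_append_of_notMem hy]
      simp only [add_assoc]
    · rw [primesBefore_append_of_notMem hu, primesBefore_append_of_notMem hx, add_assoc]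

lemma primesBefore_str (α β γ δ : SetVar) :
    primesBefore .mem (SetFormula.imp (.mem α β) (.eq γ δ)).str = α.primes ∧
    primesBefore .arrow (SetFormula.imp (.mem α β) (.eq γ δ)).str = α.primes + β.primes ∧
    primesBefore .eq (SetFormula.imp (.mem α β) (.eq γ δ)).str =
      α.primes + β.primes + γ.primes ∧
    (SetFormula.imp (.mem α β) (.eq γ δ)).str.count .prime =
      α.primes + β.primes + γ.primes + δ.primes := by
  simp [primesBefore, SetFormula.str, SetVar.str_eq_replicate, List.takeWhile_append_of_pos]
  omega

/-! ### Stratification of `[α ∈ β → γ ≐ δ]` -/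

lemma not_isStratified_mem_imp_eq (α β : SetVar) :
    ¬ (SetFormula.imp (.mem α β) (.eq α β)).IsStratified := by
  rintro ⟨σ, hm, he⟩
  have h₁ := hm ⟨α, by simp [SetFormula.vars]⟩ ⟨β, by simp [SetFormula.vars]⟩
    (by simp [SetFormula.subformulae])
  have h₂ := he ⟨α, by simp [SetFormula.vars]⟩ ⟨β, by simp [SetFormula.vars]⟩
    (by simp [SetFormula.subformulae])
  omega

/-- If `α` and `β` differ and one of them is neither `γ` nor `δ`, its level can be shifted by one
against all others. -/
lemma exists_stratification {α β γ δ : SetVar} (hαβ : α ≠ β)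
    (h : (α ≠ γ ∧ α ≠ δ) ∨ (β ≠ γ ∧ β ≠ δ)) :
    (SetFormula.imp (.mem α β) (.eq γ δ)).IsStratified := by
  rcases h with ⟨h₁, h₂⟩ | ⟨h₁, h₂⟩
  · refine ⟨fun x ↦ if x.1 = α then -1 else 0, ?_, ?_⟩
    · rintro ⟨x, _⟩ ⟨y, _⟩ h
      obtain ⟨rfl, rfl⟩ : x = α ∧ y = β := by simpa [SetFormula.subformulae] using h
      simp [hαβ.symm]
    · rintro ⟨x, _⟩ ⟨y, _⟩ h
      obtain ⟨rfl, rfl⟩ : x = γ ∧ y = δ := by simpa [SetFormula.subformulae] using h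
      simp [h₁.symm, h₂.symm]
  · refine ⟨fun x ↦ if x.1 = β then 1 else 0, ?_, ?_⟩
    · rintro ⟨x, _⟩ ⟨y, _⟩ h
      obtain ⟨rfl, rfl⟩ : x = α ∧ y = β := by simpa [SetFormula.subformulae] using h
      simp [hαβ]
    · rintro ⟨x, _⟩ ⟨y, _⟩ h
      obtain ⟨rfl, rfl⟩ : x = γ ∧ y = δ := by simpa [SetFormula.subformulae] using h
      simp [h₁.symm, h₂.symm]

/-! ### Unstratified formulae -/

theorem mainTheorem2 : ¬ unstratifiedLanguage.IsContextFree := by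
  intro hL
  obtain ⟨p, hp⟩ := hL.exists_pump_down
  -- Both numbers of primes and their difference exceed `p`.
  obtain ⟨α, hα⟩ := SetVar.exists_primes_eq (p + 1)
  obtain ⟨β, hβ⟩ := SetVar.exists_primes_eq (2 * p + 2)
  obtain ⟨s₁, s₂, s₃, s₄⟩ := primesBefore_str α β α β
  have hlong : p < (SetFormula.imp (.mem α β) (.eq α β)).str.length := by
    have := List.count_le_length (a := SetSymbol.prime)
      (l := (SetFormula.imp (.mem α β) (.eq α β)).str)
    omega
  obtain ⟨u, v, x, y, z, hs, hl, hpos, φ, hφ, hφs⟩ :=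
    hp _ ⟨_, not_isStratified_mem_imp_eq α β, rfl⟩ hlong
  have hvy := primes_of_delete hs hφs (hl.trans_lt hlong)
  have hfv : v.filter (· ≠ .prime) = [] :=
    List.filter_eq_nil_iff.2 fun c hc ↦ by
      by_contra h
      exact (hvy c (by simpa using h)).1 hc
  have hfy : y.filter (· ≠ .prime) = [] :=
    List.filter_eq_nil_iff.2 fun c hc ↦ by
      by_contra h
      exact (hvy c (by simpa using h)).2 hc
  have hcv : v.count .prime = v.length :=
    List.count_eq_length.2 fun c hc ↦ by
      by_contra h
      exact (hvy c (Ne.symm h)).1 hc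
  have hcy : y.count .prime = y.length :=
    List.count_eq_length.2 fun c hc ↦ by
      by_contra h
      exact (hvy c (Ne.symm h)).2 hc
  have hfilter := congrArg (List.filter (· ≠ .prime)) hs
  simp only [List.filter_append, hfv, hfy, List.append_nil] at hfilter
  obtain ⟨α', β', γ', δ', rfl⟩ : ∃ α' β' γ' δ', φ = .imp (.mem α' β') (.eq γ' δ') := by
    apply SetFormula.exists_of_filter_eq
    rw [hφs, List.filter_append, List.filter_append, ← hfilter]
    have hv := SetVar.filter_str
    simp only [ne_eq, decide_not] at hv
    simp [SetFormula.str, hv]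
  obtain ⟨t₁, t₂, t₃, t₄⟩ := primesBefore_str α' β' γ' δ'
  have hcoin : α' = β' ∨ (α' = γ' ∨ α' = δ') ∧ (β' = γ' ∨ β' = δ') := by
    by_contra! h
    exact hφ (exists_stratification h.1 (by tauto))
  simp only [← SetVar.primes_injective.eq_iff] at hcoin
  rw [hφs] at t₁ t₂ t₃ t₄
  rw [hs] at s₁ s₂ s₃ s₄
  simp only [List.count_append, List.length_append] at s₄ t₄ hl hpos
  have hx := List.count_le_length (a := SetSymbol.prime) (l := x)
  have d₁ := primesBefore_delete (u := u) (x := x) (hvy .mem (by simp)).1 (hvy .mem (by simp)).2 z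
  have d₂ :=
    primesBefore_delete (u := u) (x := x) (hvy .arrow (by simp)).1 (hvy .arrow (by simp)).2 z
  have d₃ := primesBefore_delete (u := u) (x := x) (hvy .eq (by simp)).1 (hvy .eq (by simp)).2 z
  rw [s₁, t₁] at d₁
  rw [s₂, t₂] at d₂
  rw [s₃, t₃] at d₃
  -- Two separators cannot both lie in `x`, as more than `p` primes stand between them.
  rcases d₁ with ⟨k₁, _, _, _⟩ | ⟨k₁, _, _, _⟩ | ⟨k₁, _, _⟩ <;>
  rcases d₂ with ⟨k₂, _, _, _⟩ | ⟨k₂, _, _, _⟩ | ⟨k₂, _, _⟩ <;>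
  rcases d₃ with ⟨k₃, _, _, _⟩ | ⟨k₃, _, _, _⟩ | ⟨k₃, _, _⟩ <;>
  omega
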